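/- **Setting.** Let $\mu=\bigotimes_{m\ge 1}N(0,1)$ be the countable product of standard Gaussian measures on $\mathbb R^{\mathbb N}$, let $\mathcal H$ be a separable real Hilbert space, and let $\Gamma\subseteq\mathbb R^{\mathbb N}$ be measurable with $\mu(\Gamma)=1$. Let $f:\Gamma\to\mathcal H$ have an extension to $\mathbb R^{\mathbb N}$ (also denoted $f$) that lies in $L^2_\mu(\mathbb R^{\mathbb N};\mathcal H)$. Let $\mathcal F$ be the set of $\nu\in\mathbb N_0^{\mathbb N}$ with finitely many nonzero entries, ordered componentwise. Let $H_\nu(\xi)=\prod_m H_{\nu_m}(\xi_m)$ be the orthonormal Hermite polynomials for $\mu$, and $f_\nu=\int f H_\nu\,d\mu\in\mathcal H$. For each $k\in\mathbb N_0$ let $\Xi^{(k)}=\{\xi^{(k)}_0,\dots,\xi^{(k)}_k\}\subset\mathbb R$ be a set of $k+1$ distinct nodes, with Lagrange interpolation operator $U_k g=\sum_{i=0}^k g(\xi_i^{(k)})L_i^{(k)}$. Put $U_{-1}=0$ and $\Delta_k=U_k-U_{k-1}$. For $\mathbf k\in\mathcal F$ let $\Xi^{(\mathbf k)}=\prod_m\Xi^{(k_m)}$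 and $\Delta_{\mathbf k}=\bigotimes_m\Delta_{k_m}$, and for finite $\Lambda\subset\mathcal F$ let $U_\Lambda=\sum_{\mathbf k\in\Lambda}\Delta_{\mathbf k}$. Assume $\Xi^{(\mathbf k)}\subset\Gamma$ for all $\mathbf k\in\mathcal F$. Assume also that the Hermite expansion represents $f$ at the nodes: for every $\mathbf k\in\mathcal F$ and every $\xi\in\Xi^{(\mathbf k)}$, $$f(\xi)=\sum_{\nu\in\mathcal F}f_\nu H_\nu(\xi)$$ with unconditional convergence in $\mathcal H$. Let $$c_\nu=\sup_{\Lambda\subset\mathcal F,\ |\Lambda|<\infty}\|(I-U_\Lambda)H_\nu\|_{L^2_\mu},\qquad \nu\in\mathcal F .$$ **Theorem.** Suppose that there are positive numbers $(b_\nu)_{\nu\in\mathcal F}$ with $\sum_{\nu\in\mathcal F}b_\nu\|f_\nu\|_{\mathcal H}^2<\infty$, a number $p\in(0,2)$, and a sequence $(\hat c_\nu)_{\nu\in\mathcal F}$ with $\sum_\nu|\hat c_\nu|^p<\infty$ that is nonincreasing ($\nu\le\tilde\nu$ implies $\hat c_\nu\ge\hat c_{\tilde\nu}$), such that $c_\nu/b_\nu^{1/2}\le\hat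 c_\nu$ for all $\nu\in\mathcal F$. Then there are a nested sequence $(\Lambda_N)_{N\ge0}$ of finite sets $\Lambda_N\subset\mathcal F$ with $|\Lambda_N|=N$, each of them monotone ($\nu\in\Lambda_N$ and $\tilde\nu\le\nu$ imply $\tilde\nu\in\Lambda_N$), and a constant $C<\infty$ independent of $N$, such that $$\|f-U_{\Lambda_N}f\|_{L^2_\mu}\le C\,(N+1)^{-(1/p-1/2)}\qquad\text{for all }N\ge0 .$$ -/

import Mathlib

open MeasureTheory ProbabilityTheory

noncomputable section

namespace SparseCollocation

/-- Multi-indices `ν ∈ ℕ₀^ℕ` with finitely many nonzero entries, ordered componentwise. -/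
abbrev MultiIndex : Type := ℕ →₀ ℕ

/-- The countable product of standard Gaussian measures on `ℝ^ℕ`. -/
def gaussianMeasure : Measure (ℕ → ℝ) :=
  Measure.infinitePi (fun _ : ℕ => gaussianReal 0 1)

/-- The univariate orthonormal Hermite polynomial of degree `n` for `N(0,1)`,
that is, the probabilists' Hermite polynomial divided by `√(n!)`. -/
def hermite1 (n : ℕ) (t : ℝ) : ℝ :=
  Polynomial.aeval t (Polynomial.hermite n) / √(n.factorial : ℝ)

/-- The multivariate orthonormal Hermite polynomial `H_ν(ξ) = ∏ₘ H_{νₘ}(ξₘ)`.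
The factors with `νₘ = 0` equal `1`, so the product runs over the support of `ν`. -/
def hermiteMulti (ν : MultiIndex) (ξ : ℕ → ℝ) : ℝ :=
  ∏ m ∈ ν.support, hermite1 (ν m) (ξ m)

/-- The Hermite coefficient `f_ν = ∫ f(ξ) H_ν(ξ) μ(dξ)`. -/
def hermiteCoeff {E : Type*} [NormedAddCommGroup E] [NormedSpace ℝ E]
    (f : (ℕ → ℝ) → E) (ν : MultiIndex) : E :=
  ∫ ξ, hermiteMulti ν ξ • f ξ ∂gaussianMeasure

/-- A family of univariate nodes: `x k 0, …, x k k` are the `k + 1` distinct nodes of the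
interpolation operator `U_k`. (The values `x k i` with `i > k` are never used.) -/
def IsNodeFamily (x : ℕ → ℕ → ℝ) : Prop :=
  ∀ k, Set.InjOn (x k) (Set.Iic k)

/-- The multivariate node `ξ_i^{(k)} = (x_{iₘ}^{(kₘ)})ₘ`. -/
def multiNode (x : ℕ → ℕ → ℝ) (k i : MultiIndex) : ℕ → ℝ :=
  fun m => x (k m) (i m)

/-- The tensor grid `Ξ^{(k)}`: the product over all `m` of the nodal sets of `U_{kₘ}`. -/
def tensorGrid (x : ℕ → ℕ → ℝ) (k : MultiIndex) : Set (ℕ → ℝ) :=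
  {ξ | ∀ m, ∃ i ≤ k m, ξ m = x (k m) i}

/-- The univariate Lagrange fundamental polynomial `L_i^{(k)}` for the nodes `x k 0, …, x k k`. -/
def lagrange1 (x : ℕ → ℕ → ℝ) (k i : ℕ) (t : ℝ) : ℝ :=
  (Lagrange.basis (Finset.range (k + 1)) (x k) i).eval t

/-- The multivariate Lagrange polynomial `L_i^{(k)}(ξ) = ∏ₘ L_{iₘ}^{(kₘ)}(ξₘ)`, for `i ≤ k`.
The factors with `kₘ = 0` equal `1`, so the product runs over the support of `k`. -/
def lagrangeMulti (x : ℕ → ℕ → ℝ) (k i : MultiIndex) (ξ : ℕ → ℝ) : ℝ :=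
  ∏ m ∈ k.support, lagrange1 x (k m) (i m) (ξ m)

/-- The tensor product interpolation operator
`(U_k f)(ξ) = ∑_{i ≤ k} f(ξ_i^{(k)}) L_i^{(k)}(ξ)`. -/
def tensorInterp {E : Type*} [AddCommGroup E] [Module ℝ E] (x : ℕ → ℕ → ℝ) (k : MultiIndex)
    (f : (ℕ → ℝ) → E) (ξ : ℕ → ℝ) : E :=
  ∑ i ∈ Finset.Iic k, lagrangeMulti x k i ξ • f (multiNode x k i)

/-- The tensorized detail operator `Δ_k = ⨂ₘ (U_{kₘ} - U_{kₘ - 1})` with `U_{-1} = 0`. Expanding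
the tensor product gives `Δ_k = ∑_S (-1)^{|S|} U_{k - 1_S}`, where `S` is the set of coordinates
in which `-U_{kₘ - 1}` is chosen; because `U_{-1} = 0` only sets `S` of coordinates
with `kₘ ≥ 1` contribute. -/
def detail {E : Type*} [AddCommGroup E] [Module ℝ E] (x : ℕ → ℕ → ℝ) (k : MultiIndex)
    (f : (ℕ → ℝ) → E) (ξ : ℕ → ℝ) : E :=
  ∑ S ∈ k.support.powerset,
    (-1 : ℝ) ^ S.card • tensorInterp x (k - Finsupp.indicator S (fun _ _ => 1)) f ξ

/-- The sparse collocation operator `U_Λ = ∑_{k ∈ Λ} Δ_k`. -/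
def sparseInterp {E : Type*} [AddCommGroup E] [Module ℝ E] (x : ℕ → ℕ → ℝ)
    (Λ : Finset MultiIndex) (f : (ℕ → ℝ) → E) (ξ : ℕ → ℝ) : E :=
  ∑ k ∈ Λ, detail x k f ξ

/-- The worst-case error `c_ν = sup_Λ ‖(I - U_Λ) H_ν‖_{L²_μ}`, over all finite sets `Λ`
of multi-indices, as an extended nonnegative number. -/
def worstCaseError (x : ℕ → ℕ → ℝ) (ν : MultiIndex) : ENNReal :=
  ⨆ Λ : Finset MultiIndex,
    eLpNorm (fun ξ => hermiteMulti ν ξ - sparseInterp x Λ (hermiteMulti ν) ξ) 2 gaussianMeasure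

end SparseCollocation

end

open SparseCollocation

namespace SparseCollocation

/-! Expand `F` in Hermite polynomials. Since `U_Λ` only samples at nodes, where the expansion is
assumed to hold, `F - U_Λ F = ∑ f_ν (I - U_Λ) H_ν` almost everywhere. For a lower set `Λ` the terms
with `ν ∈ Λ` vanish (`sparseInterp_hermiteMulti`), and the others have norm at most `c_ν ‖f_ν‖ ≤ ĉ_ν
· b_ν^{1/2} ‖f_ν‖`. Cauchy-Schwarz separates the tail of `ĉ` in `ℓ²` from the weighted coefficient
norm. If `Λ_N` collects the `N` largest `ĉ_ν`, Stechkin's estimate (`tsum_compl_sq_le`) gives the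
rate; monotonicity of `ĉ` allows these sets to be lower sets (`exists_greedy_isLowerSet`).

The choice `Λ = ∅` shows `c_ν ≥ 1`. Hence `ĉ` is positive and `∑ ‖f_ν‖ < ∞`, so the Hermite series
converges absolutely almost everywhere. That its sum is `F` requires completeness of the Hermite
polynomials on `ℝ^ℕ`: if `F` is orthogonal to all of them, the measures `F⁺μ` and `F⁻μ` give every
finite linear functional the same moments, hence the same law, and therefore coincide. -/

/-! ### Tensor-product interpolation and its exactness on Hermite polynomials. -/

/-- The univariate interpolation operator `U_k`. -/
noncomputable def univInterp (x : ℕ → ℕ → ℝ) (k : ℕ) (g : ℝ → ℝ) (t : ℝ) : ℝ :=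
  ∑ j ∈ Finset.Iic k, lagrange1 x k j t * g (x k j)

/-- The univariate detail operator `Δ_k = U_k - U_{k-1}`, with `U_{-1} = 0`. -/
noncomputable def univDetail (x : ℕ → ℕ → ℝ) (k : ℕ) (g : ℝ → ℝ) (t : ℝ) : ℝ :=
  univInterp x k g t - if k = 0 then 0 else univInterp x (k - 1) g t

lemma lagrange1_zero (x : ℕ → ℕ → ℝ) (t : ℝ) : lagrange1 x 0 0 t = 1 := by
  simp [lagrange1]

/-- Coordinates outside the support contribute `L_0^{(0)} = 1`. A common index set `M` lets products
for different multi-indices, such as `k` and `k - 1_S`, be compared factor by factor. -/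
lemma lagrangeMulti_eq_prod (x : ℕ → ℕ → ℝ) {k i : MultiIndex} (hi : i ≤ k) {M : Finset ℕ}
    (hM : k.support ⊆ M) (ξ : ℕ → ℝ) :
    lagrangeMulti x k i ξ = ∏ m ∈ M, lagrange1 x (k m) (i m) (ξ m) := by
  refine Finset.prod_subset hM fun m _ hm => ?_
  have hk : k m = 0 := by simpa using hm
  have him : i m = 0 := by have := hi m; omega
  rw [hk, him, lagrange1_zero]

lemma hermite1_zero (t : ℝ) : hermite1 0 t = 1 := by
  simp [hermite1]

lemma hermiteMulti_eq_prod {ν : MultiIndex} {M : Finset ℕ} (hM : ν.support ⊆ M) (ξ : ℕ → ℝ) :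
    hermiteMulti ν ξ = ∏ m ∈ M, hermite1 (ν m) (ξ m) := by
  refine Finset.prod_subset hM fun m _ hm => ?_
  have hk : ν m = 0 := by simpa using hm
  rw [hk, hermite1_zero]

/-- A sum of products over a box of multi-indices is the product of the univariate sums. -/
lemma sum_Iic_prod {k : MultiIndex} {M : Finset ℕ} (hM : k.support ⊆ M) (g : ℕ → ℕ → ℝ) :
    ∑ i ∈ Finset.Iic k, ∏ m ∈ M, g m (i m) = ∏ m ∈ M, ∑ j ∈ Finset.Iic (k m), g m j := by
  classical
  have h : Finset.Iic k = M.finsupp (fun m => Finset.Iic (k m)) := by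
    ext i
    simp only [Finset.mem_Iic, Finset.mem_finsupp_iff]
    constructor
    · intro hi
      refine ⟨fun m hm => hM ?_, fun m _ => hi m⟩
      have := hi m
      simp only [Finsupp.mem_support_iff] at hm ⊢
      omega
    · rintro ⟨h1, h2⟩ m
      by_cases hm : m ∈ M
      · exact h2 m hm
      · have : i m = 0 := by simpa using fun h => hm (h1 h)
        omega
  rw [h, Finset.finsupp, Finset.sum_map, Finset.prod_sum]
  refine Finset.sum_congr (by congr!) fun i _ => ?_
  rw [← Finset.prod_attach]
  refine Finset.prod_congr rfl fun m _ => ?_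
  simp

lemma tensorInterp_prod (x : ℕ → ℕ → ℝ) {k : MultiIndex} {M : Finset ℕ} (hM : k.support ⊆ M)
    (g : ℕ → ℝ → ℝ) (ξ : ℕ → ℝ) :
    tensorInterp x k (fun ξ => ∏ m ∈ M, g m (ξ m)) ξ =
      ∏ m ∈ M, univInterp x (k m) (g m) (ξ m) := by
  simp only [univInterp]
  rw [← sum_Iic_prod hM (fun m j => lagrange1 x (k m) j (ξ m) * g m (x (k m) j)), tensorInterp]
  refine Finset.sum_congr rfl fun i hi => ?_
  rw [lagrangeMulti_eq_prod x (Finset.mem_Iic.1 hi) hM, smul_eq_mul, ← Finset.prod_mul_distrib]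
  rfl

lemma detail_prod (x : ℕ → ℕ → ℝ) {k : MultiIndex} {M : Finset ℕ} (hM : k.support ⊆ M)
    (g : ℕ → ℝ → ℝ) (ξ : ℕ → ℝ) :
    detail x k (fun ξ => ∏ m ∈ M, g m (ξ m)) ξ =
      ∏ m ∈ M, univDetail x (k m) (g m) (ξ m) := by
  classical
  -- With `-U_{k-1}` as the first summand, the subset `S` produced by `Finset.prod_add` is the set
  -- of coordinates where it is chosen, as in `detail`.
  have hsub : ∀ m, univDetail x (k m) (g m) (ξ m) =
      -(if k m = 0 then 0 else univInterp x (k m - 1) (g m) (ξ m)) +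
        univInterp x (k m) (g m) (ξ m) := fun m => by rw [univDetail]; ring
  simp only [hsub]
  rw [Finset.prod_add, detail]
  refine (Finset.sum_congr rfl fun S hS => ?_).trans
    (Finset.sum_subset (Finset.powerset_mono.2 hM) fun S hS hSk => ?_)
  · have hSk := Finset.mem_powerset.1 hS
    have hSM := hSk.trans hM
    have hval : ∀ m, (k - Finsupp.indicator S (fun _ _ => 1) : MultiIndex) m =
        if m ∈ S then k m - 1 else k m := by
      intro m
      by_cases hm : m ∈ S <;> simp [hm]
    have hsupp : (k - Finsupp.indicator S (fun _ _ => 1) : MultiIndex).support ⊆ M := by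
      intro m hm
      refine hM ?_
      simp only [Finsupp.mem_support_iff, hval] at hm ⊢
      split_ifs at hm <;> omega
    generalize k - Finsupp.indicator S (fun _ _ => 1) = l at hval hsupp
    rw [tensorInterp_prod x hsupp, ← Finset.prod_sdiff hSM, Finset.prod_neg, smul_eq_mul,
      mul_assoc, mul_comm (∏ m ∈ M \ S, _)]
    refine congrArg _ (congrArg₂ _ (Finset.prod_congr rfl fun m hm => ?_)
      (Finset.prod_congr rfl fun m hm => ?_))
    · have hk : k m ≠ 0 := by simpa using hSk hm
      rw [hval, if_pos hm, if_neg hk]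
    · rw [hval, if_neg (Finset.mem_sdiff.1 hm).2]
  -- A subset `S` leaving the support of `k` picks a factor `U_{-1} = 0`.
  · obtain ⟨m, hm, hmk⟩ := Finset.not_subset.1 (fun h => hSk (Finset.mem_powerset.2 h))
    rw [Finset.prod_eq_zero hm (by simp [show k m = 0 by simpa using hmk]), zero_mul]

/-- The univariate Hermite polynomial as a real polynomial (not normalized). -/
noncomputable def hermiteReal (n : ℕ) : Polynomial ℝ :=
  (Polynomial.hermite n).map (Int.castRingHom ℝ)

lemma hermite1_eq_eval (n : ℕ) (t : ℝ) :
    hermite1 n t = (hermiteReal n).eval t / √(n.factorial : ℝ) := by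
  rw [hermite1, hermiteReal, Polynomial.eval_map, Polynomial.aeval_def]
  rfl

lemma hermiteReal_monic (n : ℕ) : (hermiteReal n).Monic :=
  (Polynomial.hermite_monic n).map _

lemma hermiteReal_natDegree (n : ℕ) : (hermiteReal n).natDegree = n := by
  rw [hermiteReal, (Polynomial.hermite_monic n).natDegree_map, Polynomial.natDegree_hermite]

lemma univInterp_hermite1 {x : ℕ → ℕ → ℝ} (hx : IsNodeFamily x) {n k : ℕ} (h : n ≤ k) (t : ℝ) :
    univInterp x k (hermite1 n) t = hermite1 n t := by
  have hdeg : (hermiteReal n).degree < (Finset.range (k + 1)).card := by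
    rw [Finset.card_range, Polynomial.degree_eq_natDegree (hermiteReal_monic n).ne_zero,
      hermiteReal_natDegree]
    exact_mod_cast Nat.lt_succ_of_le h
  have hinj : Set.InjOn (x k) (Finset.range (k + 1) : Set ℕ) := by
    refine (hx k).mono fun i hi => ?_
    have : i < k + 1 := by simpa using hi
    exact Nat.lt_succ_iff.1 this
  have key := congrArg (Polynomial.eval t) (Lagrange.eq_interpolate hinj hdeg)
  rw [Lagrange.interpolate_apply, Polynomial.eval_finsetSum] at key
  simp only [univInterp, hermite1_eq_eval, lagrange1]
  rw [key, Finset.sum_div]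
  refine Finset.sum_congr ?_ fun j _ => ?_
  · ext; simp
  · rw [Polynomial.eval_mul, Polynomial.eval_C]; ring

/-- Both `U_k` and `U_{k-1}` are exact in degree `n ≤ k - 1`, so their difference vanishes. -/
lemma univDetail_hermite1_of_lt {x : ℕ → ℕ → ℝ} (hx : IsNodeFamily x) {n k : ℕ} (h : n < k)
    (t : ℝ) : univDetail x k (hermite1 n) t = 0 := by
  rw [univDetail, if_neg (by omega), univInterp_hermite1 hx (by omega),
    univInterp_hermite1 hx (by omega), sub_self]

lemma sum_univDetail (x : ℕ → ℕ → ℝ) (k : ℕ) (g : ℝ → ℝ) (t : ℝ) :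
    ∑ j ∈ Finset.Iic k, univDetail x j g t = univInterp x k g t := by
  induction k with
  | zero =>
    have : Finset.Iic 0 = {0} := rfl
    simp [univDetail, this]
  | succ k ih =>
    have : Finset.Iic (k + 1) = insert (k + 1) (Finset.Iic k) := by
      ext; simp only [Finset.mem_Iic, Finset.mem_insert]; omega
    rw [this, Finset.sum_insert (by simp), ih, univDetail]
    simp

lemma detail_hermiteMulti_of_not_le {x : ℕ → ℕ → ℝ} (hx : IsNodeFamily x) {ν k : MultiIndex}
    (h : ¬ k ≤ ν) (ξ : ℕ → ℝ) : detail x k (hermiteMulti ν) ξ = 0 := by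
  classical
  have hM : hermiteMulti ν = fun ξ => ∏ m ∈ k.support ∪ ν.support, hermite1 (ν m) (ξ m) :=
    funext fun ξ => hermiteMulti_eq_prod Finset.subset_union_right ξ
  obtain ⟨m, hm⟩ : ∃ m, ν m < k m := by
    by_contra! hc
    exact h hc
  rw [hM, detail_prod x Finset.subset_union_left]
  refine Finset.prod_eq_zero (i := m) ?_ (univDetail_hermite1_of_lt hx hm _)
  refine Finset.mem_union_left _ ?_
  simp only [Finsupp.mem_support_iff]
  omega

/-- The sparse collocation operator reproduces the Hermite polynomials indexed by a lower set. -/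
lemma sparseInterp_hermiteMulti {x : ℕ → ℕ → ℝ} (hx : IsNodeFamily x) {Λ : Finset MultiIndex}
    (hΛ : IsLowerSet (Λ : Set MultiIndex)) {ν : MultiIndex} (hν : ν ∈ Λ) (ξ : ℕ → ℝ) :
    sparseInterp x Λ (hermiteMulti ν) ξ = hermiteMulti ν ξ := by
  have hsub : Finset.Iic ν ⊆ Λ := fun k hk => hΛ (Finset.mem_Iic.1 hk) hν
  have hM : hermiteMulti ν = fun ξ => ∏ m ∈ ν.support, hermite1 (ν m) (ξ m) := rfl
  -- Only details with `k ≤ ν` act on `H_ν`, and all of these lie in `Λ`. Their sum over the box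
  -- factorizes and telescopes in each coordinate to `U_{ν_m}`, which is exact on `H_{ν_m}`.
  rw [sparseInterp, ← Finset.sum_subset hsub fun k _ hk =>
    detail_hermiteMulti_of_not_le hx (fun h => hk (Finset.mem_Iic.2 h)) ξ]
  have h1 : ∀ k ∈ Finset.Iic ν, detail x k (hermiteMulti ν) ξ =
      ∏ m ∈ ν.support, univDetail x (k m) (hermite1 (ν m)) (ξ m) := fun k hk => by
    rw [hM, detail_prod x (Finsupp.support_mono (Finset.mem_Iic.1 hk))]
  rw [Finset.sum_congr rfl h1,
    sum_Iic_prod (subset_refl _) (fun m j => univDetail x j (hermite1 (ν m)) (ξ m)), hermiteMulti]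
  exact Finset.prod_congr rfl fun m _ => by
    rw [sum_univDetail, univInterp_hermite1 hx le_rfl]

/-! ### Collocation applied to series. -/

lemma multiNode_mem_tensorGrid (x : ℕ → ℕ → ℝ) {k i : MultiIndex} (hi : i ≤ k) :
    multiNode x k i ∈ tensorGrid x k :=
  fun m => ⟨i m, hi m, rfl⟩

/-- Collocation commutes with expansions that converge at the nodes. -/
lemma hasSum_sparseInterp {E ι : Type*} [NormedAddCommGroup E] [NormedSpace ℝ E]
    (x : ℕ → ℕ → ℝ) (φ : ι → (ℕ → ℝ) → ℝ) (c : ι → E) (F : (ℕ → ℝ) → E)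
    (h : ∀ k : MultiIndex, ∀ ξ ∈ tensorGrid x k, HasSum (fun ν => φ ν ξ • c ν) (F ξ))
    (Λ : Finset MultiIndex) (ξ : ℕ → ℝ) :
    HasSum (fun ν => sparseInterp x Λ (φ ν) ξ • c ν) (sparseInterp x Λ F ξ) := by
  -- At fixed `ξ`, `U_Λ` is a finite linear combination of evaluations at nodes, so convergence
  -- there suffices.
  simp only [sparseInterp, detail, tensorInterp, Finset.sum_smul, smul_assoc]
  refine hasSum_sum fun k _ => hasSum_sum fun S _ => HasSum.const_smul _ ?_
  exact hasSum_sum fun i hi => HasSum.const_smul _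
    (h _ _ (multiNode_mem_tensorGrid x (Finset.mem_Iic.1 hi)))

lemma continuous_hermiteMulti (ν : MultiIndex) : Continuous (hermiteMulti ν) := by
  unfold hermiteMulti
  simp only [hermite1_eq_eval]
  fun_prop

lemma continuous_sparseInterp {E : Type*} [NormedAddCommGroup E] [NormedSpace ℝ E]
    (x : ℕ → ℕ → ℝ) (Λ : Finset MultiIndex) (F : (ℕ → ℝ) → E) :
    Continuous (sparseInterp x Λ F) := by
  unfold sparseInterp detail tensorInterp lagrangeMulti lagrange1
  fun_prop

/-! ### Greedy lower sets and Stechkin's estimate. -/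

section Selection

variable {ι : Type*} [PartialOrder ι] {a : ι → ℝ}

/-- Superlevel sets of `a` are finite, so `a` attains its maximum off `Λ`. Among the maximizers an
order-minimal one is taken: anything below it has at least the same value, hence is itself or
already in `Λ`. -/
lemma exists_maximal_insert_isLowerSet [Infinite ι] [DecidableEq ι] (ha : Antitone a)
    (hpos : ∀ i, 0 < a i) (hlim : Filter.Tendsto a Filter.cofinite (nhds 0)) (Λ : Finset ι)
    (hΛ : IsLowerSet (Λ : Set ι)) :
    ∃ i ∉ Λ, (∀ j ∉ Λ, a j ≤ a i) ∧ IsLowerSet ((insert i Λ : Finset ι) : Set ι) := by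
  have hfin : ∀ i, {j | a i ≤ a j}.Finite := fun i => by
    have := hlim.eventually (gt_mem_nhds (hpos i))
    simpa [Filter.eventually_cofinite] using this
  obtain ⟨i₀, hi₀⟩ := Infinite.exists_notMem_finset Λ
  obtain ⟨i₁, ⟨hi₁, hi₁Λ⟩, hmax⟩ := ((hfin i₀).inter_of_left {j | j ∉ Λ}).exists_maximalFor a _
    ⟨i₀, le_refl (a i₀), hi₀⟩
  have hmax' : ∀ j ∉ Λ, a j ≤ a i₁ := fun j hj => by
    rcases le_total (a j) (a i₁) with h | h
    · exact h
    · exact hmax ⟨le_trans hi₁ h, hj⟩ h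
  obtain ⟨i, ⟨hi, hiΛ⟩, hmin⟩ := ((hfin i₁).inter_of_left {j | j ∉ Λ}).exists_minimal
    ⟨i₁, le_refl (a i₁), hi₁Λ⟩
  refine ⟨i, hiΛ, fun j hj => (hmax' j hj).trans hi, ?_⟩
  intro j k hkj hj
  simp only [Finset.coe_insert, Set.mem_insert_iff, Finset.mem_coe] at hj ⊢
  rcases hj with rfl | hj
  · by_cases hk : k ∈ Λ
    · exact Or.inr hk
    · exact Or.inl (le_antisymm hkj (hmin ⟨le_trans hi (ha hkj), hk⟩ hkj))
  · exact Or.inr (hΛ hkj hj)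

/-- A nested sequence of lower sets that collect the largest values of an antitone function. -/
lemma exists_greedy_isLowerSet [Infinite ι] (ha : Antitone a) (hpos : ∀ i, 0 < a i)
    (hlim : Filter.Tendsto a Filter.cofinite (nhds 0)) :
    ∃ Λ : ℕ → Finset ι, (∀ N, Λ N ⊆ Λ (N + 1)) ∧ (∀ N, IsLowerSet (Λ N : Set ι)) ∧
      (∀ N, (Λ N).card = N) ∧ ∀ N, ∀ i ∈ Λ N, ∀ j ∉ Λ N, a j ≤ a i := by
  classical
  choose! next hnext hmax hlow using exists_maximal_insert_isLowerSet ha hpos hlim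
  let Λ : ℕ → Finset ι := fun N => (fun Λ => insert (next Λ) Λ)^[N] ∅
  have hsucc : ∀ N, Λ (N + 1) = insert (next (Λ N)) (Λ N) := fun N =>
    Function.iterate_succ_apply' _ _ _
  have hlower : ∀ N, IsLowerSet ((Λ N : Finset ι) : Set ι) := by
    intro N
    induction N with
    | zero => simp [Λ, IsLowerSet]
    | succ N ih => rw [hsucc]; exact hlow _ ih
  refine ⟨Λ, fun N => by rw [hsucc]; exact Finset.subset_insert _ _, hlower, fun N => ?_,
    fun N => ?_⟩
  · induction N with
    | zero => rfl
    | succ N ih => rw [hsucc, Finset.card_insert_of_notMem (hnext _ (hlower N)), ih]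
  · induction N with
    | zero => intro i hi; simp [Λ] at hi
    | succ N ih =>
      intro i hi j hj
      rw [hsucc, Finset.mem_insert] at hi hj
      push Not at hj
      rcases hi with rfl | hi
      · exact hmax _ (hlower N) j hj.2
      · exact ih i hi j hj.2

omit [PartialOrder ι] in
/-- Stechkin's bound for the tail of a `p`-summable sequence after its `N` largest terms. -/
lemma tsum_compl_sq_le {p : ℝ} (hp0 : 0 < p) (hp2 : p < 2) (hpos : ∀ i, 0 < a i)
    (hsum : Summable fun i => a i ^ p) {Λ : Finset ι}
    (hΛ : ∀ i ∈ Λ, ∀ j ∉ Λ, a j ≤ a i) :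
    Summable (fun i => Set.indicator {i | i ∉ Λ} (fun i => a i ^ 2) i) ∧
      ∑' i, Set.indicator {i | i ∉ Λ} (fun i => a i ^ 2) i ≤
        ((∑' i, a i ^ p) ^ (1 / p) * ((Λ.card : ℝ) + 1) ^ (-(1 / p - 1 / 2))) ^ 2 := by
  classical
  set S := ∑' i, a i ^ p with hS
  have hS0 : 0 ≤ S := tsum_nonneg fun i => Real.rpow_nonneg (hpos i).le _
  set n : ℝ := (Λ.card : ℝ) + 1 with hn
  have hn0 : 0 < n := by positivity
  -- `a j` is dominated by the `|Λ|` selected values and by itself, so `|Λ| + 1` terms of the series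
  -- are at least `a j ^ p`.
  have hbound : ∀ j ∉ Λ, a j ^ p ≤ S / n := by
    intro j hj
    rw [le_div_iff₀ hn0]
    calc a j ^ p * n = ∑ i ∈ insert j Λ, a j ^ p := by
          rw [Finset.sum_const, Finset.card_insert_of_notMem hj, nsmul_eq_mul, hn]; push_cast; ring
      _ ≤ ∑ i ∈ insert j Λ, a i ^ p := by
          refine Finset.sum_le_sum fun i hi => ?_
          rcases Finset.mem_insert.1 hi with rfl | hi
          · exact le_rfl
          · exact Real.rpow_le_rpow (hpos j).le (hΛ i hi j hj) hp0.le
      _ ≤ S := hsum.sum_le_tsum _ fun i _ => Real.rpow_nonneg (hpos i).le _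
  -- Off `Λ`, split `a² = a^(2-p) · a^p` and bound the first factor by `hbound`.
  have hterm : ∀ i, Set.indicator {i | i ∉ Λ} (fun i => a i ^ 2) i ≤
      (S / n) ^ ((2 - p) / p) * a i ^ p := by
    intro i
    by_cases hi : i ∈ Λ
    · rw [Set.indicator_of_notMem (by simpa using hi)]
      have := (hpos i).le
      positivity
    · rw [Set.indicator_of_mem (by simpa using hi)]
      calc a i ^ 2 = (a i ^ p) ^ ((2 - p) / p) * a i ^ p := by
            rw [← Real.rpow_mul (hpos i).le, ← Real.rpow_add (hpos i), mul_div_cancel₀ _ hp0.ne',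
              sub_add_cancel]
            norm_cast
        _ ≤ _ := by
            have h1 := Real.rpow_nonneg (hpos i).le p
            refine mul_le_mul_of_nonneg_right ?_ h1
            exact Real.rpow_le_rpow h1 (hbound i hi) (div_nonneg (by linarith) hp0.le)
  have hsummable : Summable (fun i => Set.indicator {i | i ∉ Λ} (fun i => a i ^ 2) i) :=
    Summable.of_nonneg_of_le (fun i => Set.indicator_nonneg (fun i _ => sq_nonneg _) i) hterm
      (hsum.mul_left _)
  refine ⟨hsummable, (hsummable.tsum_le_tsum hterm (hsum.mul_left _)).trans_eq ?_⟩
  rw [tsum_mul_left, ← hS]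
  -- `S = 0` is treated apart because combining the powers of `S` divides by it.
  rcases hS0.eq_or_lt with h0 | h0
  · rw [← h0, Real.zero_rpow (by positivity)]; simp
  · rw [Real.div_rpow hS0 hn0.le, mul_pow, ← Real.rpow_natCast, ← Real.rpow_natCast,
      ← Real.rpow_mul hS0, ← Real.rpow_mul hn0.le, div_mul_eq_mul_div, ← Real.rpow_add_one h0.ne',
      div_eq_mul_inv, ← Real.rpow_neg hn0.le]
    congr 2
    · push_cast; field_simp; ring
    · push_cast; field_simp

end Selection

/-! ### Orthonormality of the Hermite polynomials. -/

open Polynomial in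
lemma integrable_eval_gaussianReal (P : ℝ[X]) :
    Integrable (fun t => P.eval t) (gaussianReal 0 1) := by
  simp only [Polynomial.eval_eq_sum_range]
  refine integrable_finsetSum _ fun i _ => Integrable.const_mul ?_ _
  have := (memLp_id_gaussianReal' (μ := 0) (v := 1) (i : ENNReal) (by simp)).integrable_norm_pow'
  refine (integrable_norm_iff (by fun_prop)).1 ?_
  simpa using this

open Polynomial in
/-- Stein's identity for polynomials. -/
lemma integral_eval_stein (P : ℝ[X]) :
    ∫ t, (X * P - derivative P).eval t ∂gaussianReal 0 1 = 0 := by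
  have hpdf : ∀ Q : ℝ[X], Integrable fun t => gaussianPDFReal 0 1 t * Q.eval t := fun Q => by
    have := integrable_eval_gaussianReal Q
    rw [gaussianReal_of_var_ne_zero 0 one_ne_zero,
      integrable_withDensity_iff_integrable_smul' (measurable_gaussianPDF 0 1)
        (by simp [gaussianPDF])] at this
    simpa [gaussianPDF, ENNReal.toReal_ofReal (gaussianPDFReal_nonneg 0 1 _)] using this
  rw [integral_gaussianReal_eq_integral_smul one_ne_zero]
  simp only [smul_eq_mul]
  -- Since the density satisfies `φ' = -tφ`, the integrand is the derivative of `-φP`; the integral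
  -- over the line vanishes.
  have hderiv : ∀ t, HasDerivAt (fun t => -(gaussianPDFReal 0 1 t * P.eval t))
      (gaussianPDFReal 0 1 t * (X * P - derivative P).eval t) t := by
    intro t
    have h1 : HasDerivAt (gaussianPDFReal 0 1) (gaussianPDFReal 0 1 t * (-t)) t := by
      have h2 : HasDerivAt (fun t : ℝ => -(t - 0) ^ 2 / (2 * ((1 : NNReal) : ℝ))) (-t) t := by
        have h3 := (((hasDerivAt_id' t).sub_const 0).fun_pow 2).fun_neg.div_const
          (2 * ((1 : NNReal) : ℝ))
        refine h3.congr_deriv ?_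
        simp
        ring
      rw [gaussianPDFReal_def]
      refine (h2.exp.const_mul (√(2 * Real.pi * ((1 : NNReal) : ℝ)))⁻¹).congr_deriv ?_
      ring
    refine (h1.fun_mul (P.hasDerivAt t)).fun_neg.congr_deriv ?_
    rw [Polynomial.eval_sub, Polynomial.eval_mul, Polynomial.eval_X]
    ring
  exact integral_eq_zero_of_hasDerivAt_of_integrable hderiv (hpdf _) (hpdf P).neg

open Polynomial in
lemma hermiteReal_succ (n : ℕ) :
    hermiteReal (n + 1) = X * hermiteReal n - derivative (hermiteReal n) := by
  simp [hermiteReal, Polynomial.derivative_map]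

-- By Stein's identity `Q ↦ XQ - Q'` is adjoint to differentiation, and `n` applications of it to
-- `1` give the Hermite polynomial.
open Polynomial in
lemma integral_hermiteReal_mul (n : ℕ) (Q : ℝ[X]) :
    ∫ t, (hermiteReal n * Q).eval t ∂gaussianReal 0 1 =
      ∫ t, (derivative^[n] Q).eval t ∂gaussianReal 0 1 := by
  induction n generalizing Q with
  | zero => simp [hermiteReal]
  | succ n ih =>
    rw [Function.iterate_succ_apply, ← ih, ← sub_eq_zero, ← integral_sub
      (integrable_eval_gaussianReal _) (integrable_eval_gaussianReal _)]
    refine Eq.trans ?_ (integral_eval_stein (hermiteReal n * Q))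
    congr 1 with t
    rw [← Polynomial.eval_sub, hermiteReal_succ, Polynomial.derivative_mul]
    congr 1
    ring

open Polynomial in
lemma integral_hermiteReal_mul_of_lt {m n : ℕ} (h : m < n) :
    ∫ t, (hermiteReal n * hermiteReal m).eval t ∂gaussianReal 0 1 = 0 := by
  rw [integral_hermiteReal_mul, Polynomial.iterate_derivative_eq_zero]
  · simp
  · rwa [hermiteReal_natDegree]

open Polynomial in
lemma integral_hermiteReal_mul_self (n : ℕ) :
    ∫ t, (hermiteReal n * hermiteReal n).eval t ∂gaussianReal 0 1 = n.factorial := by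
  have h : derivative^[n] (hermiteReal n) = C (n.factorial : ℝ) := by
    have hdeg : (derivative^[n] (hermiteReal n)).natDegree = 0 := by
      have := Polynomial.natDegree_iterate_derivative (hermiteReal n) n
      rw [hermiteReal_natDegree] at this
      omega
    rw [Polynomial.eq_C_of_natDegree_eq_zero hdeg, Polynomial.coeff_iterate_derivative]
    have := hermiteReal_monic n
    rw [Polynomial.Monic, Polynomial.leadingCoeff, hermiteReal_natDegree] at this
    simp [this, Nat.descFactorial_self]
  rw [integral_hermiteReal_mul, h]
  simp

lemma integral_hermite1_mul (m n : ℕ) :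
    ∫ t, hermite1 m t * hermite1 n t ∂gaussianReal 0 1 = if m = n then 1 else 0 := by
  have h : ∀ t, hermite1 m t * hermite1 n t =
      (hermiteReal m * hermiteReal n).eval t / (√(m.factorial : ℝ) * √(n.factorial : ℝ)) :=
    fun t => by rw [hermite1_eq_eval, hermite1_eq_eval, Polynomial.eval_mul]; ring
  simp only [h]
  rw [integral_div]
  rcases lt_trichotomy m n with hmn | rfl | hmn
  · rw [mul_comm, integral_hermiteReal_mul_of_lt hmn, if_neg hmn.ne, zero_div]
  · rw [integral_hermiteReal_mul_self, if_pos rfl, Real.mul_self_sqrt (by positivity)]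
    exact div_self (by positivity)
  · rw [integral_hermiteReal_mul_of_lt hmn, if_neg hmn.ne', zero_div]

instance : IsProbabilityMeasure gaussianMeasure := by
  unfold gaussianMeasure; infer_instance

lemma integral_prod_gaussianMeasure (M : Finset ℕ) (g : ℕ → ℝ → ℝ)
    (hg : ∀ m, Measurable (g m)) :
    ∫ ξ, ∏ m ∈ M, g m (ξ m) ∂gaussianMeasure = ∏ m ∈ M, ∫ t, g m t ∂gaussianReal 0 1 := by
  have := integral_restrict_infinitePi
    (μ := fun _ : ℕ => gaussianReal 0 1) (s := M)
    (f := fun y => ∏ m : M, g m (y m))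
    (Measurable.aestronglyMeasurable (by fun_prop))
  rw [integral_fintype_prod_eq_prod (fun (m : M) t => g m t)] at this
  rw [← Finset.prod_coe_sort M fun m => ∫ t, g m t ∂gaussianReal 0 1, ← this]
  unfold gaussianMeasure
  congr with ξ
  rw [← Finset.prod_coe_sort M]
  rfl

/-- The multivariate Hermite polynomials are orthonormal. -/
lemma integral_hermiteMulti_mul (ν κ : MultiIndex) :
    ∫ ξ, hermiteMulti ν ξ * hermiteMulti κ ξ ∂gaussianMeasure = if ν = κ then 1 else 0 := by
  classical
  have h : ∀ ξ, hermiteMulti ν ξ * hermiteMulti κ ξ =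
      ∏ m ∈ ν.support ∪ κ.support, hermite1 (ν m) (ξ m) * hermite1 (κ m) (ξ m) := fun ξ => by
    rw [hermiteMulti_eq_prod Finset.subset_union_left,
      hermiteMulti_eq_prod (ν := κ) Finset.subset_union_right, Finset.prod_mul_distrib]
  simp only [h]
  rw [integral_prod_gaussianMeasure _ (fun m t => hermite1 (ν m) t * hermite1 (κ m) t)
    (fun m => by simp only [hermite1_eq_eval]; fun_prop)]
  simp only [integral_hermite1_mul]
  split_ifs with hν
  · simp [hν]
  · obtain ⟨m, hm⟩ := DFunLike.ne_iff.1 hν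
    refine Finset.prod_eq_zero (i := m) ?_ (if_neg hm)
    by_contra hc
    simp only [Finset.mem_union, Finsupp.mem_support_iff, not_or, not_not] at hc
    exact hm (hc.1.trans hc.2.symm)

lemma memLp_hermiteMulti (ν : MultiIndex) : MemLp (hermiteMulti ν) 2 gaussianMeasure := by
  rw [memLp_two_iff_integrable_sq (continuous_hermiteMulti ν).aestronglyMeasurable]
  simp only [pow_two]
  -- A non-integrable function has Bochner integral `0`, but this integral is `1`.
  refine not_not.1 fun h => ?_
  have := integral_hermiteMulti_mul ν ν
  rw [integral_undef h] at this
  simp at this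

lemma eLpNorm_hermiteMulti (ν : MultiIndex) : eLpNorm (hermiteMulti ν) 2 gaussianMeasure = 1 := by
  rw [(memLp_hermiteMulti ν).eLpNorm_eq_integral_rpow_norm (by simp) (by simp)]
  have := integral_hermiteMulti_mul ν ν
  simp [← pow_two] at this
  simp [this]

/-! ### Completeness of the Hermite polynomials. -/

open Polynomial in
lemma exists_eq_sum_hermiteReal (n : ℕ) (P : ℝ[X]) (hP : P.natDegree ≤ n) :
    ∃ c : ℕ → ℝ, ∀ t, P.eval t = ∑ j ∈ Finset.Iic n, c j * hermite1 j t := by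
  induction n generalizing P with
  | zero =>
    refine ⟨fun _ => P.coeff 0, fun t => ?_⟩
    have h : Finset.Iic 0 = {0} := rfl
    rw [h, Finset.sum_singleton, hermite1_zero, mul_one]
    conv_lhs => rw [Polynomial.eq_C_of_natDegree_eq_zero (Nat.le_zero.1 hP)]
    simp
  | succ n ih =>
    have hdeg : (P - C (P.coeff (n + 1)) * hermiteReal (n + 1)).natDegree ≤ n := by
      rw [Polynomial.natDegree_le_iff_coeff_eq_zero]
      intro m hm
      rw [Polynomial.coeff_sub, Polynomial.coeff_C_mul]
      rcases (Nat.succ_le_of_lt hm).eq_or_lt with rfl | hm'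
      · have := hermiteReal_monic (n + 1)
        rw [Polynomial.Monic, Polynomial.leadingCoeff, hermiteReal_natDegree] at this
        simp [this]
      · rw [Polynomial.coeff_eq_zero_of_natDegree_lt (lt_of_le_of_lt hP hm'),
          Polynomial.coeff_eq_zero_of_natDegree_lt (n := m) (p := hermiteReal (n + 1))
            (by rwa [hermiteReal_natDegree])]
        simp
    obtain ⟨c, hc⟩ := ih _ hdeg
    -- The leading term is removed by a monic Hermite polynomial; the square root undoes the
    -- normalization of `hermite1`.
    refine ⟨Function.update c (n + 1) (P.coeff (n + 1) * √((n + 1).factorial : ℝ)), fun t => ?_⟩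
    have h : Finset.Iic (n + 1) = insert (n + 1) (Finset.Iic n) := by
      ext; simp only [Finset.mem_Iic, Finset.mem_insert]; omega
    have h2 : ∑ j ∈ Finset.Iic n, Function.update c (n + 1)
        (P.coeff (n + 1) * √((n + 1).factorial : ℝ)) j * hermite1 j t =
        ∑ j ∈ Finset.Iic n, c j * hermite1 j t := Finset.sum_congr rfl fun j hj => by
      have : j ≠ n + 1 := by have := Finset.mem_Iic.1 hj; omega
      rw [Function.update_of_ne this]
    rw [h, Finset.sum_insert (by simp), h2, ← hc, Function.update_self, hermite1_eq_eval,
      Polynomial.eval_sub, Polynomial.eval_mul, Polynomial.eval_C]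
    have : √((n + 1).factorial : ℝ) ≠ 0 := by positivity
    field_simp
    ring

/-- Monomials are finite linear combinations of Hermite polynomials. -/
lemma exists_monomial_eq_sum_hermiteMulti (M : Finset ℕ) (k : ℕ → ℕ) :
    ∃ (s : Finset MultiIndex) (c : MultiIndex → ℝ), ∀ ξ : ℕ → ℝ,
      ∏ m ∈ M, ξ m ^ k m = ∑ ν ∈ s, c ν * hermiteMulti ν ξ := by
  classical
  choose c hc using fun n => exists_eq_sum_hermiteReal n (Polynomial.X ^ n)
    (Polynomial.natDegree_X_pow_le n)
  let κ : MultiIndex := Finsupp.indicator M (fun m _ => k m)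
  have hκM : κ.support ⊆ M := Finsupp.support_indicator_subset _ _
  refine ⟨Finset.Iic κ, fun ν => ∏ m ∈ M, c (k m) (ν m), fun ξ => ?_⟩
  have h : ∀ m ∈ M, ξ m ^ k m =
      ∑ j ∈ Finset.Iic (κ m), c (k m) j * hermite1 j (ξ m) := fun m hm => by
    have := hc (k m) (ξ m)
    rw [Polynomial.eval_pow, Polynomial.eval_X] at this
    rw [this]
    simp [κ, hm]
  rw [Finset.prod_congr rfl h, ← sum_Iic_prod hκM fun m j => c (k m) j * hermite1 j (ξ m)]
  refine Finset.sum_congr rfl fun ν hν => ?_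
  rw [hermiteMulti_eq_prod ((Finsupp.support_mono (Finset.mem_Iic.1 hν)).trans hκM),
    Finset.prod_mul_distrib]

lemma exists_linear_pow_eq_sum_hermiteMulti (M : Finset ℕ) (w : ℕ → ℝ) (n : ℕ) :
    ∃ (s : Finset MultiIndex) (c : MultiIndex → ℝ), ∀ ξ : ℕ → ℝ,
      (∑ m ∈ M, w m * ξ m) ^ n = ∑ ν ∈ s, c ν * hermiteMulti ν ξ := by
  classical
  choose s c hc using fun k : ℕ → ℕ => exists_monomial_eq_sum_hermiteMulti M k
  let A := Finset.piAntidiag M n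
  refine ⟨A.biUnion s, fun ν => ∑ k ∈ A, (Nat.multinomial M k * ∏ m ∈ M, w m ^ k m) *
    if ν ∈ s k then c k ν else 0, fun ξ => ?_⟩
  rw [Finset.sum_pow_eq_sum_piAntidiag]
  simp only [Finset.sum_mul]
  rw [Finset.sum_comm]
  refine Finset.sum_congr rfl fun k hk => ?_
  simp only [mul_pow]
  rw [Finset.prod_mul_distrib, hc k ξ, ← mul_assoc, Finset.mul_sum]
  refine Finset.sum_subset_zero_on_sdiff (Finset.subset_biUnion_of_mem s hk) (fun ν hν => ?_)
    fun ν hν => ?_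
  · rw [if_neg (Finset.mem_sdiff.1 hν).2]; simp
  · rw [if_pos hν]; ring

lemma memLp_exp_linear (M : Finset ℕ) (w : ℕ → ℝ) (s : ℝ) :
    MemLp (fun ξ : ℕ → ℝ => Real.exp (s * ∑ m ∈ M, w m * ξ m)) 2 gaussianMeasure := by
  rw [memLp_two_iff_integrable_sq (Measurable.aestronglyMeasurable (by fun_prop))]
  -- The integral of the square is a product of positive one-dimensional integrals, so it cannot be
  -- the default value `0`.
  refine not_not.1 fun h => ?_
  have h1 := integral_prod_gaussianMeasure M (fun m t => Real.exp ((2 * s * w m) * t))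
    (fun m => by fun_prop)
  have h2 : ∀ ξ : ℕ → ℝ, ∏ m ∈ M, Real.exp ((2 * s * w m) * ξ m) =
      Real.exp (s * ∑ m ∈ M, w m * ξ m) ^ 2 := fun ξ => by
    rw [← Real.exp_sum, ← Real.exp_nat_mul, Finset.mul_sum, Finset.mul_sum]
    congr 1
    refine Finset.sum_congr rfl fun m _ => ?_
    push_cast; ring
  simp only [h2] at h1
  rw [integral_undef h] at h1
  refine (Finset.prod_pos fun m _ => ?_).ne h1
  exact integral_exp_pos (integrable_exp_mul_gaussianReal _)

/-- Two finite measures for which a random variable has all exponential moments and equal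
moments give it the same law. -/
lemma map_eq_of_moments_eq {Ω : Type*} [MeasurableSpace Ω] {μ₁ μ₂ : Measure Ω}
    [IsFiniteMeasure μ₁] [IsFiniteMeasure μ₂] {X : Ω → ℝ} (hX : Measurable X)
    (h₁ : ∀ s, Integrable (fun ω => Real.exp (s * X ω)) μ₁)
    (h₂ : ∀ s, Integrable (fun ω => Real.exp (s * X ω)) μ₂)
    (h : ∀ n : ℕ, ∫ ω, X ω ^ n ∂μ₁ = ∫ ω, X ω ^ n ∂μ₂) :
    μ₁.map X = μ₂.map X := by
  have e₁ : integrableExpSet X μ₁ = Set.univ := Set.eq_univ_of_forall h₁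
  have e₂ : integrableExpSet X μ₂ = Set.univ := Set.eq_univ_of_forall h₂
  have hmgf : mgf X μ₁ = mgf X μ₂ := by
    -- Both moment generating functions are analytic on `ℝ`, and their Taylor coefficients at `0`
    -- are given by the moments.
    refine AnalyticOnNhd.eq_of_eventuallyEq (𝕜 := ℝ) (z₀ := 0) ?_ ?_ ?_
    · have := analyticOnNhd_mgf (X := X) (μ := μ₁)
      rwa [e₁, interior_univ] at this
    · have := analyticOnNhd_mgf (X := X) (μ := μ₂)
      rwa [e₂, interior_univ] at this
    · have p₁ := hasFPowerSeriesAt_mgf (X := X) (μ := μ₁) (v := 0) (by simp [e₁])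
      have p₂ := hasFPowerSeriesAt_mgf (X := X) (μ := μ₂) (v := 0) (by simp [e₂])
      simp only [zero_mul, Real.exp_zero, mul_one, h] at p₁ p₂
      exact (p₁.eventually_hasSum_sub.and p₂.eventually_hasSum_sub).mono
        fun y hy => hy.1.unique hy.2
  have hzero : μ₁ = 0 ↔ μ₂ = 0 := by
    have := congrFun hmgf 0
    rw [mgf_zero', mgf_zero', measureReal_def, measureReal_def, ENNReal.toReal_eq_toReal_iff'
      (measure_ne_top _ _) (measure_ne_top _ _)] at this
    rw [← Measure.measure_univ_eq_zero, ← Measure.measure_univ_eq_zero, this]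
  refine Measure.ext_of_complexMGF_eq hX.aemeasurable hX.aemeasurable (funext fun z => ?_)
  exact eqOn_complexMGF_of_mgf' hmgf hzero (by simp [e₁])

/-- Finite measures on `ℝ^ℕ` that agree on all finite linear functionals are equal. -/
lemma ext_of_map_linear {μ₁ μ₂ : Measure (ℕ → ℝ)} [IsFiniteMeasure μ₁] [IsFiniteMeasure μ₂]
    (h : ∀ (M : Finset ℕ) (w : ℕ → ℝ), μ₁.map (fun ξ => ∑ m ∈ M, w m * ξ m) =
      μ₂.map (fun ξ => ∑ m ∈ M, w m * ξ m)) : μ₁ = μ₂ := by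
  classical
  have hI : ∀ I : Finset ℕ, μ₁.map I.restrict = μ₂.map I.restrict := by
    intro I
    refine Measure.ext_of_charFunDual (funext fun L => ?_)
    -- Cramér-Wold: a functional on finitely many coordinates is a weighted sum, so the
    -- characteristic function at `L` depends only on the law of that sum.
    let w : ℕ → ℝ := fun m => if hm : m ∈ I then L (Pi.single ⟨m, hm⟩ 1) else 0
    have hL : ∀ ξ : ℕ → ℝ, L (I.restrict ξ) = ∑ m ∈ I, w m * ξ m := by
      intro ξ
      rw [← Finset.sum_coe_sort I, ← ContinuousLinearMap.coe_coe,
        LinearMap.pi_apply_eq_sum_univ]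
      refine Finset.sum_congr rfl fun m _ => ?_
      simp only [w, Subtype.coe_eta, Finset.coe_mem, dif_pos, smul_eq_mul, Finset.restrict]
      rw [mul_comm]
      refine congrArg (· * ξ m) (congrArg L (funext fun j => ?_))
      simp [Pi.single_apply, eq_comm]
    have hmeas : Measurable fun ξ : ℕ → ℝ => ∑ m ∈ I, w m * ξ m := by fun_prop
    have hchar : ∀ μ : Measure (ℕ → ℝ), charFunDual (μ.map I.restrict) L =
        ∫ t : ℝ, Complex.exp (t * Complex.I) ∂(μ.map fun ξ => ∑ m ∈ I, w m * ξ m) := by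
      intro μ
      rw [charFunDual_apply, integral_map (by fun_prop)
        (Continuous.aestronglyMeasurable (by fun_prop)),
        integral_map hmeas.aemeasurable (Continuous.aestronglyMeasurable (by fun_prop))]
      simp only [hL]
    rw [hchar, hchar, h]
  refine IsProjectiveLimit.unique (P := fun I : Finset ℕ => μ₂.map I.restrict) hI fun I => rfl

/-- The Hermite polynomials are complete in `L²`. -/
lemma ae_eq_zero_of_integral_hermiteMulti_mul_eq_zero {F : (ℕ → ℝ) → ℝ}
    (hF : MemLp F 2 gaussianMeasure)
    (h : ∀ ν, ∫ ξ, hermiteMulti ν ξ * F ξ ∂gaussianMeasure = 0) :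
    F =ᵐ[gaussianMeasure] 0 := by
  have hF1 : Integrable F gaussianMeasure := hF.integrable (by norm_num)
  have hfin : ∀ G : (ℕ → ℝ) → ℝ, Integrable G gaussianMeasure →
      IsFiniteMeasure (gaussianMeasure.withDensity fun ξ => ENNReal.ofReal (G ξ)) := fun G hG =>
    isFiniteMeasure_withDensity_ofReal hG.2
  have := hfin F hF1
  have := hfin (fun ξ => -F ξ) hF1.neg
  have hm : AEMeasurable F gaussianMeasure := hF.1.aemeasurable
  have hm' : AEMeasurable (fun ξ => -F ξ) gaussianMeasure := hm.neg
  have hint : ∀ G : (ℕ → ℝ) → ℝ, MemLp G 2 gaussianMeasure → ∀ X : (ℕ → ℝ) → ℝ,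
      MemLp X 2 gaussianMeasure →
      Integrable X (gaussianMeasure.withDensity fun ξ => ENNReal.ofReal (G ξ)) := by
    intro G hG X hX
    rw [integrable_withDensity_iff_integrable_smul₀' hG.1.aemeasurable.ennreal_ofReal (by simp)]
    refine ((hG.integrable_mul hX).norm).mono' ?_ (Filter.Eventually.of_forall fun ξ => ?_)
    · exact hG.1.aemeasurable.ennreal_ofReal.ennreal_toReal.aestronglyMeasurable.smul hX.1
    · simp only [norm_smul, Pi.mul_apply, norm_mul]
      refine mul_le_mul_of_nonneg_right ?_ (norm_nonneg _)
      rw [Real.norm_of_nonneg ENNReal.toReal_nonneg, ENNReal.toReal_ofReal']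
      exact max_le (le_abs_self _) (abs_nonneg _)
  -- `ENNReal.ofReal` truncates at `0`, so these are `F⁺μ` and `F⁻μ`. Moments of linear functionals
  -- agree because their powers lie in the Hermite span, to which `F⁺ - F⁻ = F` is orthogonal.
  have hmeas : (gaussianMeasure.withDensity fun ξ => ENNReal.ofReal (F ξ)) =
      gaussianMeasure.withDensity fun ξ => ENNReal.ofReal (-F ξ) := by
    refine ext_of_map_linear fun M w => map_eq_of_moments_eq (by fun_prop)
      (fun s => hint F hF _ (memLp_exp_linear M w s))
      (fun s => hint _ hF.neg _ (memLp_exp_linear M w s)) fun n => ?_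
    obtain ⟨s, c, hc⟩ := exists_linear_pow_eq_sum_hermiteMulti M w n
    have hpow : MemLp (fun ξ : ℕ → ℝ => (∑ m ∈ M, w m * ξ m) ^ n) 2 gaussianMeasure := by
      simp only [hc]
      exact memLp_finsetSum _ fun ν _ => (memLp_hermiteMulti ν).const_mul _
    have hzero : ∫ ξ : ℕ → ℝ, F ξ * (∑ m ∈ M, w m * ξ m) ^ n ∂gaussianMeasure = 0 := by
      simp only [hc, Finset.mul_sum]
      have hi : ∀ ν ∈ s, Integrable (fun ξ => F ξ * (c ν * hermiteMulti ν ξ)) gaussianMeasure :=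
        fun ν _ => hF.integrable_mul ((memLp_hermiteMulti ν).const_mul (c ν))
      rw [integral_finsetSum _ hi]
      refine Finset.sum_eq_zero fun ν _ => ?_
      rw [← mul_zero (c ν), ← h ν, ← integral_const_mul]
      congr 1 with ξ
      ring
    have i₁ := hint F hF _ hpow
    have i₂ := hint (fun ξ => -F ξ) hF.neg _ hpow
    rw [integrable_withDensity_iff_integrable_smul₀' hm.ennreal_ofReal (by simp)] at i₁
    rw [integrable_withDensity_iff_integrable_smul₀' hm'.ennreal_ofReal (by simp)] at i₂
    rw [integral_withDensity_eq_integral_toReal_smul₀ hm.ennreal_ofReal (by simp),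
      integral_withDensity_eq_integral_toReal_smul₀ hm'.ennreal_ofReal (by simp),
      ← sub_eq_zero, ← integral_sub i₁ i₂, ← hzero]
    congr 1 with ξ
    simp only [smul_eq_mul, ENNReal.toReal_ofReal']
    rw [← sub_mul]
    congr 1
    rcases le_total (F ξ) 0 with h0 | h0
    · rw [max_eq_right h0, max_eq_left (by linarith)]; ring
    · rw [max_eq_left h0, max_eq_right (by linarith)]; ring
  rw [withDensity_eq_iff_of_sigmaFinite hm.ennreal_ofReal hm'.ennreal_ofReal] at hmeas
  filter_upwards [hmeas] with ξ hξ
  have := congrArg ENNReal.toReal hξ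
  rw [ENNReal.toReal_ofReal', ENNReal.toReal_ofReal'] at this
  rcases le_total (F ξ) 0 with h0 | h0
  · rw [max_eq_right h0, max_eq_left (by linarith)] at this
    simp only [Pi.zero_apply]; linarith
  · rw [max_eq_left h0, max_eq_right (by linarith)] at this
    simpa using this

/-- Reduces to the scalar case by pairing with each `c : H`; separability merges the null sets. -/
lemma ae_eq_zero_of_hermiteCoeff_eq_zero {H : Type*} [NormedAddCommGroup H]
    [InnerProductSpace ℝ H] [CompleteSpace H] [TopologicalSpace.SeparableSpace H]
    {F : (ℕ → ℝ) → H} (hF : MemLp F 2 gaussianMeasure) (h : ∀ ν, hermiteCoeff F ν = 0) :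
    F =ᵐ[gaussianMeasure] 0 := by
  have := UniformSpace.secondCountable_of_separable H
  refine ae_eq_zero_of_forall_inner (𝕜 := ℝ) fun c => ?_
  refine ae_eq_zero_of_integral_hermiteMulti_mul_eq_zero (hF.const_inner c) fun ν => ?_
  have hint : Integrable (fun ξ => hermiteMulti ν ξ • F ξ) gaussianMeasure :=
    memLp_one_iff_integrable.1 (hF.smul (memLp_hermiteMulti ν))
  have := integral_inner (𝕜 := ℝ) hint c
  rw [show ∫ ξ, hermiteMulti ν ξ • F ξ ∂gaussianMeasure = 0 from h ν, inner_zero_right] at this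
  simpa only [inner_smul_right] using this

/-! ### Almost everywhere Hermite expansion and the error bound. -/

/-- Minkowski bounds the partial sums; lower semicontinuity of the norm (Fatou) passes to the limit.
-/
lemma eLpNorm_le_tsum_of_hasSum {Ω ι E : Type*} [MeasurableSpace Ω] [Countable ι]
    [NormedAddCommGroup E] {μ : Measure Ω} {p : ENNReal} (hp : 1 ≤ p) {T : ι → Ω → E} {G : Ω → E}
    (hT : ∀ i, AEStronglyMeasurable (T i) μ)
    (hG : ∀ᵐ ω ∂μ, HasSum (fun i => T i ω) (G ω)) :
    eLpNorm G p μ ≤ ∑' i, eLpNorm (T i) p μ := by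
  refine Lp.eLpNorm_le_of_ae_tendsto (u := Filter.atTop)
    (f := fun (s : Finset ι) ω => ∑ i ∈ s, T i ω) (Filter.Eventually.of_forall fun s => ?_)
    (fun s => Finset.aestronglyMeasurable_fun_sum s fun i _ => hT i) hG
  have h : (fun ω => ∑ i ∈ s, T i ω) = ∑ i ∈ s, T i := by ext ω; simp
  rw [h]
  exact (eLpNorm_sum_le (fun i _ => hT i) hp).trans (ENNReal.sum_le_tsum s)

lemma eLpNorm_smul_const {Ω E : Type*} [MeasurableSpace Ω] [NormedAddCommGroup E]
    [NormedSpace ℝ E] (μ : Measure Ω) (p : ENNReal) (g : Ω → ℝ) (c : E) :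
    eLpNorm (fun ω => g ω • c) p μ = ‖c‖ₑ * eLpNorm g p μ := by
  have h : eLpNorm (fun ω => g ω • c) p μ = eLpNorm (‖c‖ • g) p μ :=
    eLpNorm_congr_norm_ae (Filter.Eventually.of_forall fun ω => by simp [norm_smul, mul_comm])
  rw [h, eLpNorm_const_smul, enorm_norm]

section Expansion

variable {H : Type*} [NormedAddCommGroup H] [InnerProductSpace ℝ H] [CompleteSpace H]

lemma integral_abs_hermiteMulti_mul_le (κ ν : MultiIndex) :
    ∫ ξ, |hermiteMulti κ ξ * hermiteMulti ν ξ| ∂gaussianMeasure ≤ 1 := by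
  have hi : ∀ ν, Integrable (fun ξ => hermiteMulti ν ξ * hermiteMulti ν ξ) gaussianMeasure :=
    fun ν => (memLp_hermiteMulti ν).integrable_mul (memLp_hermiteMulti ν)
  calc ∫ ξ, |hermiteMulti κ ξ * hermiteMulti ν ξ| ∂gaussianMeasure
      ≤ ∫ ξ, (hermiteMulti κ ξ * hermiteMulti κ ξ + hermiteMulti ν ξ * hermiteMulti ν ξ) / 2
          ∂gaussianMeasure := by
        refine integral_mono_of_nonneg (Filter.Eventually.of_forall fun ξ => abs_nonneg _)
          (((hi κ).add (hi ν)).div_const 2) (Filter.Eventually.of_forall fun ξ => ?_)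
        dsimp only
        rw [abs_le]
        constructor <;> nlinarith [sq_nonneg (hermiteMulti κ ξ - hermiteMulti ν ξ),
          sq_nonneg (hermiteMulti κ ξ + hermiteMulti ν ξ)]
    _ = 1 := by
        rw [integral_div, integral_add (hi κ) (hi ν), integral_hermiteMulti_mul,
          integral_hermiteMulti_mul]
        norm_num

/-- A square integrable function with absolutely summable Hermite coefficients is the sum of its
Hermite series almost everywhere. -/
lemma ae_hasSum_hermiteMulti [TopologicalSpace.SeparableSpace H] {F : (ℕ → ℝ) → H}
    (hF : MemLp F 2 gaussianMeasure) (hc : Summable fun ν => ‖hermiteCoeff F ν‖) :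
    ∀ᵐ ξ ∂gaussianMeasure, HasSum (fun ν => hermiteMulti ν ξ • hermiteCoeff F ν) (F ξ) := by
  set c := hermiteCoeff F with hcdef
  have hT : ∀ ν, AEStronglyMeasurable (fun ξ => hermiteMulti ν ξ • c ν) gaussianMeasure :=
    fun ν => ((continuous_hermiteMulti ν).smul continuous_const).aestronglyMeasurable
  have hsum : ∑' ν, eLpNorm (fun ξ => hermiteMulti ν ξ • c ν) 2 gaussianMeasure ≠ ⊤ := by
    simp only [eLpNorm_smul_const, eLpNorm_hermiteMulti, mul_one]
    exact tsum_enorm_ne_top_iff_summable_norm.2 hc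
  set G : (ℕ → ℝ) → H := fun ξ => ∑' ν, hermiteMulti ν ξ • c ν with hGdef
  have hG : ∀ᵐ ξ ∂gaussianMeasure, HasSum (fun ν => hermiteMulti ν ξ • c ν) (G ξ) := by
    filter_upwards [summable_norm_of_tsum_eLpNorm_ne_top (by norm_num) hT hsum] with ξ hξ
    exact hξ.of_norm.hasSum
  have hGm : MemLp G 2 gaussianMeasure := by
    refine ⟨?_, (eLpNorm_le_tsum_of_hasSum (by norm_num) hT hG).trans_lt hsum.lt_top⟩
    exact aestronglyMeasurable_of_tendsto_ae Filter.atTop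
      (f := fun (s : Finset MultiIndex) ξ => ∑ ν ∈ s, hermiteMulti ν ξ • c ν)
      (fun s => Finset.aestronglyMeasurable_fun_sum s fun ν _ => hT ν) hG
  have hint : ∀ κ ν, Integrable (fun ξ => (hermiteMulti κ ξ * hermiteMulti ν ξ) • c ν)
      gaussianMeasure := fun κ ν =>
    Integrable.smul_const ((memLp_hermiteMulti κ).integrable_mul (memLp_hermiteMulti ν)) _
  -- Termwise integration is justified by `∫ |H_κ H_ν| ≤ 1` and the summability of `‖c ν‖`.
  have hcoeff : ∀ κ, hermiteCoeff G κ = c κ := by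
    intro κ
    have h1 := hasSum_integral_of_summable_integral_norm (hint κ) (by
      refine Summable.of_nonneg_of_le (fun ν => integral_nonneg fun ξ => norm_nonneg _)
        (fun ν => ?_) hc
      simp only [norm_smul, integral_mul_const]
      exact mul_le_of_le_one_left (norm_nonneg _) (integral_abs_hermiteMulti_mul_le κ ν))
    have h2 : ∫ ξ, ∑' ν, (hermiteMulti κ ξ * hermiteMulti ν ξ) • c ν ∂gaussianMeasure =
        hermiteCoeff G κ := by
      refine integral_congr_ae ?_
      filter_upwards [hG] with ξ hξ
      simp only [mul_smul]
      exact (hξ.const_smul _).tsum_eq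
    rw [h2] at h1
    refine h1.unique ?_
    simp only [integral_smul_const, integral_hermiteMulti_mul]
    convert hasSum_ite_eq κ (c κ) using 2 with ν
    by_cases h : ν = κ
    · subst h; simp
    · simp [h, Ne.symm h]
  have hsmul : ∀ K : (ℕ → ℝ) → H, MemLp K 2 gaussianMeasure → ∀ ν,
      Integrable (fun ξ => hermiteMulti ν ξ • K ξ) gaussianMeasure := fun K hK ν =>
    memLp_one_iff_integrable.1 (hK.smul (memLp_hermiteMulti ν))
  have hzero : F - G =ᵐ[gaussianMeasure] 0 := by
    refine ae_eq_zero_of_hermiteCoeff_eq_zero (hF.sub hGm) fun ν => ?_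
    have : hermiteCoeff (F - G) ν = hermiteCoeff F ν - hermiteCoeff G ν := by
      simp only [hermiteCoeff, Pi.sub_apply, smul_sub]
      exact integral_sub (hsmul F hF ν) (hsmul G hGm ν)
    rw [this, hcoeff, hcdef, sub_self]
  filter_upwards [hzero, hG] with ξ h1 h2
  have : F ξ = G ξ := sub_eq_zero.1 h1
  rwa [this]

/-- The collocation error is bounded by the errors for the Hermite polynomials outside `Λ`. -/
lemma eLpNorm_sub_sparseInterp_le [TopologicalSpace.SeparableSpace H] {F : (ℕ → ℝ) → H}
    (hF : MemLp F 2 gaussianMeasure) (hc : Summable fun ν => ‖hermiteCoeff F ν‖)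
    {x : ℕ → ℕ → ℝ} (hx : IsNodeFamily x)
    (hPCE : ∀ k : MultiIndex, ∀ ξ ∈ tensorGrid x k,
      HasSum (fun ν => hermiteMulti ν ξ • hermiteCoeff F ν) (F ξ))
    {Λ : Finset MultiIndex} (hΛ : IsLowerSet (Λ : Set MultiIndex)) :
    eLpNorm (fun ξ => F ξ - sparseInterp x Λ F ξ) 2 gaussianMeasure ≤
      ∑' ν, ‖hermiteCoeff F ν‖ₑ * Set.indicator {ν | ν ∉ Λ} (worstCaseError x) ν := by
  refine (eLpNorm_le_tsum_of_hasSum (p := 2) (by norm_num) (T := fun ν ξ =>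
    (hermiteMulti ν ξ - sparseInterp x Λ (hermiteMulti ν) ξ) • hermiteCoeff F ν)
    (fun ν => ?_) ?_).trans (ENNReal.tsum_le_tsum fun ν => ?_)
  · exact (((continuous_hermiteMulti ν).sub (continuous_sparseInterp x Λ _)).smul
      continuous_const).aestronglyMeasurable
  -- Almost everywhere convergence handles `F ξ` but says nothing at individual nodes; `hPCE`
  -- supplies the expansion used for `U_Λ F`.
  · filter_upwards [ae_hasSum_hermiteMulti hF hc] with ξ hξ
    simp only [sub_smul]
    exact hξ.sub (hasSum_sparseInterp x hermiteMulti _ F hPCE Λ ξ)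
  · rw [eLpNorm_smul_const]
    gcongr
    by_cases hν : ν ∈ Λ
    · simp [sparseInterp_hermiteMulti hx hΛ hν]
    · rw [Set.indicator_of_mem (by simpa using hν)]
      exact le_iSup (fun Λ : Finset MultiIndex => eLpNorm (fun ξ => hermiteMulti ν ξ -
        sparseInterp x Λ (hermiteMulti ν) ξ) 2 gaussianMeasure) Λ

end Expansion

/-! ### The convergence rate. -/

/-- For `Λ = ∅` the error is `H_ν` itself, of norm one. -/
lemma one_le_worstCaseError (x : ℕ → ℕ → ℝ) (ν : MultiIndex) : 1 ≤ worstCaseError x ν := by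
  refine le_trans ?_ (le_iSup _ ∅)
  simp [sparseInterp, eLpNorm_hermiteMulti]

end SparseCollocation

theorem mainTheorem5 {H : Type*} [NormedAddCommGroup H] [InnerProductSpace ℝ H] [CompleteSpace H]
    [TopologicalSpace.SeparableSpace H]
    -- the domain, the function and a square integrable extension of it
    (Γ : Set (ℕ → ℝ)) (hΓ : MeasurableSet Γ) (hμΓ : gaussianMeasure Γ = 1)
    (f : Γ → H) (F : (ℕ → ℝ) → H) (hFf : ∀ ξ : Γ, F ξ = f ξ) (hF : MemLp F 2 gaussianMeasure)
    -- the univariate interpolation nodes; all tensor grids lie in the domain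
    (x : ℕ → ℕ → ℝ) (hx : IsNodeFamily x) (hxΓ : ∀ k : MultiIndex, tensorGrid x k ⊆ Γ)
    -- the Hermite expansion represents the function at the interpolation nodes
    (hPCE : ∀ ξ : Γ, (∃ k : MultiIndex, (ξ : ℕ → ℝ) ∈ tensorGrid x k) →
      HasSum (fun ν : MultiIndex => hermiteMulti ν ξ • hermiteCoeff F ν) (f ξ))
    -- weighted square summability of the Hermite coefficients
    (b : MultiIndex → ℝ) (hb : ∀ ν, 0 < b ν)
    (hbf : Summable (fun ν : MultiIndex => b ν * ‖hermiteCoeff F ν‖ ^ 2))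
    -- the nonincreasing p-summable dominating sequence
    (p : ℝ) (hp0 : 0 < p) (hp2 : p < 2)
    (chat : MultiIndex → ℝ) (hanti : Antitone chat)
    (hchat : Summable (fun ν : MultiIndex => |chat ν| ^ p))
    (hdom : ∀ ν, worstCaseError x ν / ENNReal.ofReal (b ν ^ (1 / 2 : ℝ)) ≤
      ENNReal.ofReal (chat ν)) :
    ∃ Λ : ℕ → Finset MultiIndex,
      (∀ N, Λ N ⊆ Λ (N + 1)) ∧
      (∀ N, IsLowerSet (Λ N : Set MultiIndex)) ∧
      (∀ N, (Λ N).card = N) ∧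
      ∃ C : ℝ, ∀ N : ℕ,
        eLpNorm (fun ξ => F ξ - sparseInterp x (Λ N) F ξ) 2 gaussianMeasure ≤
          ENNReal.ofReal (C * ((N : ℝ) + 1) ^ (-(1 / p - 1 / 2))) := by
  have hsq : ∀ ν, 0 < √(b ν) := fun ν => Real.sqrt_pos.2 (hb ν)
  simp only [← Real.sqrt_eq_rpow] at hdom
  have hpos : ∀ ν, 0 < chat ν := fun ν => by
    have h : 0 < worstCaseError x ν / ENNReal.ofReal √(b ν) :=
      ENNReal.div_pos (zero_lt_one.trans_le (one_le_worstCaseError x ν)).ne' ENNReal.ofReal_ne_top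
    exact ENNReal.ofReal_pos.1 (h.trans_le (hdom ν))
  have hW : ∀ ν, worstCaseError x ν ≤ ENNReal.ofReal (chat ν * √(b ν)) := fun ν => by
    rw [ENNReal.ofReal_mul (hpos ν).le]
    exact (ENNReal.div_le_iff (ENNReal.ofReal_pos.2 (hsq ν)).ne' ENNReal.ofReal_ne_top).1 (hdom ν)
  have hsump : Summable fun ν => chat ν ^ p := by
    refine hchat.congr fun ν => ?_
    rw [abs_of_pos (hpos ν)]
  have hlim : Filter.Tendsto chat Filter.cofinite (nhds 0) := by
    have h := hsump.tendsto_cofinite_zero.rpow_const (p := 1 / p) (Or.inr (by positivity))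
    rw [Real.zero_rpow (by positivity)] at h
    refine h.congr fun ν => ?_
    rw [← Real.rpow_mul (hpos ν).le, mul_one_div_cancel hp0.ne', Real.rpow_one]
  obtain ⟨Λ, hnest, hlow, hcard, hgreedy⟩ := exists_greedy_isLowerSet hanti hpos hlim
  refine ⟨Λ, hnest, hlow, hcard, ?_⟩
  set B := ∑' ν, b ν * ‖hermiteCoeff F ν‖ ^ 2 with hB
  set S := ∑' ν, chat ν ^ p with hS
  have htail := fun N => tsum_compl_sq_le hp0 hp2 hpos hsump (hgreedy N)
  -- Cauchy-Schwarz, with Stechkin's bound for the tail of `chat` and `√B` for the weighted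
  -- coefficients.
  have hCS : ∀ N, Summable (fun ν => Set.indicator {ν | ν ∉ Λ N} chat ν *
        (√(b ν) * ‖hermiteCoeff F ν‖)) ∧
      ∑' ν, Set.indicator {ν | ν ∉ Λ N} chat ν * (√(b ν) * ‖hermiteCoeff F ν‖) ≤
        S ^ (1 / p) * √B * ((N : ℝ) + 1) ^ (-(1 / p - 1 / 2)) := by
    intro N
    have hf2 : ∀ ν, Set.indicator {ν | ν ∉ Λ N} chat ν ^ (2 : ℝ) =
        Set.indicator {ν | ν ∉ Λ N} (fun ν => chat ν ^ 2) ν := fun ν => by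
      by_cases h : ν ∈ Λ N <;> simp [h]
    have hg2 : ∀ ν, (√(b ν) * ‖hermiteCoeff F ν‖) ^ (2 : ℝ) = b ν * ‖hermiteCoeff F ν‖ ^ 2 :=
      fun ν => by rw [Real.rpow_two, mul_pow, Real.sq_sqrt (hb ν).le]
    have key := Real.summable_and_inner_le_Lp_mul_Lq_tsum_of_nonneg Real.HolderConjugate.two_two
      (f := Set.indicator {ν | ν ∉ Λ N} chat) (g := fun ν => √(b ν) * ‖hermiteCoeff F ν‖)
      (fun ν => Set.indicator_nonneg (fun ν _ => (hpos ν).le) ν) (fun ν => by positivity)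
      (by simpa only [hf2] using (htail N).1) (by simpa only [hg2] using hbf)
    refine ⟨key.1, key.2.trans ?_⟩
    simp only [hf2, hg2, ← Real.sqrt_eq_rpow, ← hB]
    have h1 := Real.sqrt_le_sqrt (htail N).2
    have hS0 : 0 ≤ S := tsum_nonneg fun ν => Real.rpow_nonneg (hpos ν).le _
    rw [Real.sqrt_sq (by positivity), hcard] at h1
    calc _ ≤ S ^ (1 / p) * ((N : ℝ) + 1) ^ (-(1 / p - 1 / 2)) * √B :=
          mul_le_mul_of_nonneg_right h1 (Real.sqrt_nonneg _)
      _ = _ := by ring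
  -- The case `N = 0` of `hCS` sums over all `ν`, and `1 ≤ c_ν ≤ chat ν * √(b ν)` removes the
  -- weights.
  have hc : Summable fun ν => ‖hermiteCoeff F ν‖ := by
    have h0 : Λ 0 = ∅ := Finset.card_eq_zero.1 (hcard 0)
    refine Summable.of_nonneg_of_le (fun ν => norm_nonneg _) (fun ν => ?_) (hCS 0).1
    have h1 : 1 ≤ chat ν * √(b ν) := by
      rw [← ENNReal.one_le_ofReal]
      exact (one_le_worstCaseError x ν).trans (hW ν)
    rw [h0]
    simp only [Finset.notMem_empty, not_false_eq_true, Set.ofPred_true, Set.indicator_univ]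
    rw [← mul_assoc]
    exact le_mul_of_one_le_left (norm_nonneg _) h1
  have hnodes : ∀ k : MultiIndex, ∀ ξ ∈ tensorGrid x k,
      HasSum (fun ν => hermiteMulti ν ξ • hermiteCoeff F ν) (F ξ) := fun k ξ hξ => by
    rw [hFf ⟨ξ, hxΓ k hξ⟩]
    exact hPCE ⟨ξ, hxΓ k hξ⟩ ⟨k, hξ⟩
  refine ⟨S ^ (1 / p) * √B, fun N => ?_⟩
  calc eLpNorm (fun ξ => F ξ - sparseInterp x (Λ N) F ξ) 2 gaussianMeasure
      ≤ ∑' ν, ‖hermiteCoeff F ν‖ₑ * Set.indicator {ν | ν ∉ Λ N} (worstCaseError x) ν :=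
        eLpNorm_sub_sparseInterp_le hF hc hx hnodes (hlow N)
    _ ≤ ∑' ν, ENNReal.ofReal (Set.indicator {ν | ν ∉ Λ N} chat ν *
          (√(b ν) * ‖hermiteCoeff F ν‖)) := by
        refine ENNReal.tsum_le_tsum fun ν => ?_
        by_cases hν : ν ∈ Λ N
        · simp [hν]
        · rw [Set.indicator_of_mem (by simpa using hν), Set.indicator_of_mem (by simpa using hν),
            ← mul_assoc, ENNReal.ofReal_mul (by have := hpos ν; positivity), ofReal_norm, mul_comm]
          gcongr
          exact hW ν
    _ = ENNReal.ofReal (∑' ν, Set.indicator {ν | ν ∉ Λ N} chat ν *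
          (√(b ν) * ‖hermiteCoeff F ν‖)) :=
        (ENNReal.ofReal_tsum_of_nonneg (fun ν => mul_nonneg
          (Set.indicator_nonneg (fun ν _ => (hpos ν).le) ν) (by positivity)) (hCS N).1).symm
    _ ≤ _ := ENNReal.ofReal_le_ofReal (hCS N).2
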